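/- Consider a network with a finite set $J$ of resources with capacities $C_j>0$ and a finite set $I$ of flow types. Flows of type $i$ can use the resources in a nonempty set $J(i)\subseteq J$ (routes of length one), and there are $n_i\ge 0$ flows of type $i$, with $n_i>0$ for at least one $i$. Let $U$ be a common utility function, strictly increasing on $[0,\infty)$ and strictly concave and differentiable on $(0,\infty)$, real-valued except that $U(0)=-\infty$ is allowed. Let $x=(x_i)_{i\in I}$ be the rate allocation, i.e. the maximizer of $\sum_{i\in I} n_iU(x_i)$ (with $0\cdot(-\infty)=0$) subject to $$\sum_{i:\,j\in J(i)} n_i x_i^j\le C_j\ (j\in J),\qquad \sum_{j\in J(i)}x_i^j=x_i\ (i\in I),\qquad x_i^j\ge 0\ (i\in I,\ j\in J(i)),$$ with the convention $x_i=0$ if $n_i=0$. For $J'\subseteq J$ put $C(J')=\sum_{j\in J'}C_j$ and $I(J')=\{i\in I: J(i)\subseteq J'\}$. For $I'\subseteq I$ and $\emptyset\ne J'\subseteq J$, the pair $(I',J')$ is called connected if $J'$ cannot be partitioned into nonempty sets $J_1,J_2$ such that $I'$ can be partitioned into (possibly empty) sets $I_1,I_2$ with $J(i)\cap J_2=\emptyset$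 for $i\in I_1$ and $J(i)\cap J_1=\emptyset$ for $i\in I_2$. Let $\mathscr{C}(J)$ be the set of connected $J'$, those for which $(I,J')$ is connected, and $\mathscr{SC}(J)$ the set of strongly connected $J'$, those for which $(I(J'),J')$ is connected. Below, sets $J'$ for which the denominator vanishes are left out. Then: 1. The minimal rate over all flows present is $$\min_{i\in I:\,n_i>0}x_i=\min_{J'\in\mathscr{SC}(J)}\frac{C(J')}{\sum_{i\in I(J')}n_i}.$$ 2. If every resource that some flow type can use can also be used by a flow type with $n_i>0$ (in particular, if all $n_i>0$), the maximal rate is $$\max_{i\in I}x_i=\max_{J'\in\mathscr{C}(J)}\frac{C(J')}{\sum_{i:\,J(i)\cap J'\ne\emptyset}n_i}.$$ -/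

import Mathlib

open Finset

namespace MultipathRouting

variable {I J : Type*} [Fintype I] [Fintype J] [DecidableEq I] [DecidableEq J]

/-- A common utility function of the rate `x ≥ 0`: strictly increasing on `[0, ∞)`, strictly
concave and differentiable on `(0, ∞)`. The value at `0` may be a real number or `-∞`
(as for `log`). Strict monotonicity forces `U x` to be a real number for every `x > 0`
(as `U 0 < U x < U (x + 1)`), and then `toReal` there is the honest value. -/
structure IsUtility (U : ℝ → EReal) : Prop where
  strictMonoOn : StrictMonoOn U (Set.Ici 0)
  strictConcaveOn : StrictConcaveOn ℝ (Set.Ioi 0) (fun x => (U x).toReal)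
  differentiableOn : DifferentiableOn ℝ (fun x => (U x).toReal) (Set.Ioi 0)

/-- The rate vector `x` is feasible: each `x i` can be split into rates `y i j ≥ 0` over the
resources `j ∈ res i` so that no capacity is exceeded. Here `res i` is the set of resources that
flows of type `i` can use, `C j` the capacity of `j`, `n i` the number of flows of type `i`. -/
def IsFeasible (res : I → Finset J) (C : J → ℝ) (n : I → ℝ) (x : I → ℝ) : Prop :=
  ∃ y : I → J → ℝ,
    (∀ i, ∀ j ∈ res i, 0 ≤ y i j) ∧
    (∀ i, ∑ j ∈ res i, y i j = x i) ∧
    (∀ j, ∑ i with j ∈ res i, n i * y i j ≤ C j)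

/-- Total utility. In `EReal`, `0 * ⊥ = 0`, so types without flows do not contribute. -/
noncomputable def totalUtility (U : ℝ → EReal) (n : I → ℝ) (x : I → ℝ) : EReal :=
  ∑ i, (n i : EReal) * U (x i)

/-- `x` is the rate allocation at `n`: it maximizes the total utility over all feasible rate
vectors, with the convention that types without flows have rate `0`. -/
def IsRateAllocation (U : ℝ → EReal) (res : I → Finset J) (C : J → ℝ) (n : I → ℝ)
    (x : I → ℝ) : Prop :=
  IsFeasible res C n x ∧ (∀ i, n i = 0 → x i = 0) ∧
    ∀ x' : I → ℝ, IsFeasible res C n x' → totalUtility U n x' ≤ totalUtility U n x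

/-- `(I', J')` is connected: `J'` is nonempty and cannot be partitioned into nonempty `J₁`, `J₂`
for which `I'` can be partitioned into (possibly empty) `I₁`, `I₂` such that no `i ∈ I₁` can use a
resource in `J₂` and no `i ∈ I₂` can use a resource in `J₁`. -/
def IsConnectedPair (res : I → Finset J) (I' : Finset I) (J' : Finset J) : Prop :=
  J'.Nonempty ∧
  ¬ ∃ J₁ J₂ : Finset J, J₁.Nonempty ∧ J₂.Nonempty ∧ Disjoint J₁ J₂ ∧ J₁ ∪ J₂ = J' ∧
      ∃ I₁ I₂ : Finset I, Disjoint I₁ I₂ ∧ I₁ ∪ I₂ = I' ∧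
        (∀ i ∈ I₁, Disjoint (res i) J₂) ∧ (∀ i ∈ I₂, Disjoint (res i) J₁)

/-- `I(J')`: the types that can only use resources in `J'`. -/
def confinedTo (res : I → Finset J) (J' : Finset J) : Finset I :=
  univ.filter fun i => res i ⊆ J'

/-- The types that can use some resource in `J'`. -/
def touching (res : I → Finset J) (J' : Finset J) : Finset I :=
  univ.filter fun i => (res i ∩ J').Nonempty

/-- The family of connected sets of resources. -/
def connectedSets (res : I → Finset J) : Set (Finset J) :=
  {J' | IsConnectedPair res univ J'}

/-- The family of strongly connected sets of resources. -/
def stronglyConnectedSets (res : I → Finset J) : Set (Finset J) :=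
  {J' | IsConnectedPair res (confinedTo res J') J'}

end MultipathRouting

set_option linter.unusedSectionVars false

namespace MultipathRouting

/-! ### Secant inequalities for the utility function, including at rate zero. -/

section Utility

variable {U : ℝ → EReal}

/-! An optimal split is fair: on a resource that two present types can use, moving load from the
better-off to the worse-off raises total utility by strict concavity, and leftover capacity would
raise it by monotonicity (`IsRateAllocation.exists_isFairSplit`). Let m and M be the extreme rates.
Counting the load on a set J' of resources in two ways bounds C(J') below by m times the number of
flows confined to J', and above by M times the number of flows touching J'
(`IsSplit.mul_confined_le`, `IsFairSplit.le_mul_touching`). By fairness the lower bound is tight for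
the resources available to the worst-off present types, and the upper bound for those used by the
best-off (`IsFairSplit.exists_tight_confined`, `IsFairSplit.exists_tight_touching`). If a tight set
were disconnected, adding the bounds for its two parts would force both parts to be tight. Hence an
inclusion-minimal tight set is connected in the relevant sense, and the extrema are attained on the
stated families. -/

theorem IsUtility.ne_top (hU : IsUtility U) {t : ℝ} (ht : 0 ≤ t) : U t ≠ ⊤ :=
  ne_top_of_lt (hU.strictMonoOn (Set.mem_Ici.2 ht) (Set.mem_Ici.2 (by linarith : 0 ≤ t + 1))
    (by linarith))

theorem IsUtility.ne_bot (hU : IsUtility U) {t : ℝ} (ht : 0 < t) : U t ≠ ⊥ :=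
  ne_bot_of_gt (hU.strictMonoOn (Set.mem_Ici.2 le_rfl) (Set.mem_Ici.2 ht.le) ht)

theorem IsUtility.toReal_lt (hU : IsUtility U) {s t : ℝ} (hs : 0 ≤ s) (hb : U s ≠ ⊥)
    (hst : s < t) : (U s).toReal < (U t).toReal := by
  have ht : 0 < t := hs.trans_lt hst
  have h := hU.strictMonoOn (Set.mem_Ici.2 hs) (Set.mem_Ici.2 ht.le) hst
  rwa [← EReal.coe_toReal (hU.ne_top hs) hb, ← EReal.coe_toReal (hU.ne_top ht.le) (hU.ne_bot ht),
    EReal.coe_lt_coe_iff] at h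

/-- Adjacent secants have decreasing slopes, even if the left one starts at `0`. -/
theorem IsUtility.slope_le (hU : IsUtility U) {r s t : ℝ} (hr : 0 ≤ r) (hb : U r ≠ ⊥)
    (hrs : r < s) (hst : s < t) :
    ((U t).toReal - (U s).toReal) * (s - r) ≤ ((U s).toReal - (U r).toReal) * (t - s) := by
  -- Concavity is only available on the open ray, so `r` is approached by `q > r`. Monotonicity, `U
  -- r < U q`, replaces continuity at `r`, which may fail at `0`.
  have key : ∀ q, r < q → q < s →
      ((U t).toReal - (U s).toReal) * (s - q) ≤ ((U s).toReal - (U r).toReal) * (t - s) := by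
    intro q hrq hqs
    have h := hU.strictConcaveOn.slope_anti_adjacent (x := q) (y := s) (z := t)
      (Set.mem_Ioi.2 (hr.trans_lt hrq)) (Set.mem_Ioi.2 (by linarith)) hqs hst
    rw [div_lt_div_iff₀ (by linarith) (by linarith)] at h
    have h2 := hU.toReal_lt hr hb hrq
    have : ((U s).toReal - (U q).toReal) * (t - s) ≤ ((U s).toReal - (U r).toReal) * (t - s) :=
      mul_le_mul_of_nonneg_right (by linarith) (by linarith)
    linarith
  have hlim : Filter.Tendsto (fun q : ℝ => ((U t).toReal - (U s).toReal) * (s - q))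
      (nhdsWithin r (Set.Ioi r)) (nhds (((U t).toReal - (U s).toReal) * (s - r))) :=
    ((by fun_prop : Continuous fun q : ℝ => ((U t).toReal - (U s).toReal) * (s - q)).tendsto
      r).mono_left nhdsWithin_le_nhds
  refine le_of_tendsto hlim ?_
  filter_upwards [Ioo_mem_nhdsGT hrs] with q hq using key q hq.1 hq.2

/-- Transferring rate from the better-off of two flow types to the worse-off one, without
reversing their order, increases total utility. -/
theorem IsUtility.transfer_lt (hU : IsUtility U) {p q a b v w : ℝ} (hp : 0 ≤ p) (hb : U p ≠ ⊥)
    (ha0 : 0 < a) (hb0 : 0 < b) (hpq : p + b < q - a) (hv : 0 < v) (hvw : v * a = w * b) :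
    v * (U q).toReal + w * (U p).toReal
      < v * (U (q - a)).toReal + w * (U (p + b)).toReal := by
  have h1 := hU.slope_le hp hb (by linarith : p < p + b) hpq
  have h2 := hU.strictConcaveOn.slope_anti_adjacent (x := p + b) (y := q - a) (z := q)
      (Set.mem_Ioi.2 (by linarith)) (Set.mem_Ioi.2 (by linarith)) hpq (by linarith)
  rw [div_lt_div_iff₀ (by linarith) (by linarith)] at h2
  set A := (U q).toReal - (U (q - a)).toReal with hA
  set B := (U (q - a)).toReal - (U (p + b)).toReal with hB
  set D := (U (p + b)).toReal - (U p).toReal with hD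
  set l := q - a - (p + b) with hl
  have hl0 : 0 < l := by rw [hl]; linarith
  have e1 : B * b ≤ D * l := by simpa using h1
  have e2 : A * l < B * a := by simpa using h2
  have hw : 0 < w := pos_of_mul_pos_left (hvw ▸ mul_pos hv ha0) hb0.le
  have h3 : (v * A) * l < (w * D) * l := by
    calc (v * A) * l = v * (A * l) := by ring
      _ < v * (B * a) := mul_lt_mul_of_pos_left e2 hv
      _ = (v * a) * B := by ring
      _ = w * (B * b) := by rw [hvw]; ring
      _ ≤ w * (D * l) := mul_le_mul_of_nonneg_left e1 hw.le
      _ = _ := by ring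
  have h4 := lt_of_mul_lt_mul_right h3 hl0.le
  rw [hA, hD] at h4
  linarith

end Utility

/-! ### Optimality of the rate allocation implies fairness. -/

section Allocation

variable {I J : Type*} [Fintype I] [Fintype J] [DecidableEq I] [DecidableEq J]
  {res : I → Finset J} {C : J → ℝ} {n x : I → ℝ} {U : ℝ → EReal}

/-- `y` splits the rates `x` over the resources within the capacities. -/
structure IsSplit (res : I → Finset J) (C : J → ℝ) (n x : I → ℝ) (y : I → J → ℝ) : Prop where
  nonneg : ∀ i, ∀ j ∈ res i, 0 ≤ y i j
  sum_eq : ∀ i, ∑ j ∈ res i, y i j = x i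
  load_le : ∀ j, ∑ i with j ∈ res i, n i * y i j ≤ C j

/-- A split of the rate allocation: every flow type only uses those of its resources that no
worse-off type could use, and every resource that can be used is fully used. -/
structure IsFairSplit (res : I → Finset J) (C : J → ℝ) (n x : I → ℝ) (y : I → J → ℝ) : Prop
    extends IsSplit res C n x y where
  le_of_used : ∀ i k j, 0 < n i → 0 < n k → j ∈ res i → j ∈ res k → 0 < y i j → x i ≤ x k
  load_eq : ∀ i j, 0 < n i → j ∈ res i → ∑ k with j ∈ res k, n k * y k j = C j

theorem IsSplit.rate_nonneg {y : I → J → ℝ} (hy : IsSplit res C n x y) (i : I) : 0 ≤ x i := by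
  rw [← hy.sum_eq i]
  exact sum_nonneg (hy.nonneg i)

/-- Changing the rates on one resource `j` by `d`. -/
theorem IsSplit.shift {y : I → J → ℝ} (hy : IsSplit res C n x y) (j : J) (d : I → ℝ)
    (hd : ∀ i, j ∉ res i → d i = 0) (hnonneg : ∀ i, j ∈ res i → 0 ≤ y i j + d i)
    (hload : ∑ i with j ∈ res i, n i * y i j + ∑ i, n i * d i ≤ C j) :
    IsFeasible res C n (fun i => x i + d i) := by
  refine ⟨fun i j' => y i j' + if j' = j then d i else 0, ?_, ?_, ?_⟩
  · intro i j' hj'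
    by_cases h : j' = j
    · subst h; simpa using hnonneg i hj'
    · simpa [h] using hy.nonneg i j' hj'
  · intro i
    rw [sum_add_distrib, hy.sum_eq i, sum_ite_eq']
    by_cases h : j ∈ res i
    · simp [h]
    · simp [h, hd i h]
  · intro j'
    by_cases h : j' = j
    · subst h
      have : ∑ i with j' ∈ res i, n i * d i = ∑ i, n i * d i :=
        sum_filter_of_ne fun i _ hne => by
          by_contra hi
          exact hne (by rw [hd i hi, mul_zero])
      simpa [mul_add, sum_add_distrib, this] using hload
    · simpa [h] using hy.load_le j'

theorem totalUtility_eq_coe (hU : IsUtility U) (hn : ∀ i, 0 ≤ n i) (hx : ∀ i, 0 ≤ x i)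
    (hb : ∀ i, 0 < n i → U (x i) ≠ ⊥) :
    totalUtility U n x = ((∑ i, n i * (U (x i)).toReal : ℝ) : EReal) := by
  refine Eq.trans ?_ (map_sum (⟨⟨Real.toEReal, EReal.coe_zero⟩, EReal.coe_add⟩ : ℝ →+ EReal)
    (fun i => n i * (U (x i)).toReal) univ).symm
  refine sum_congr rfl fun i _ => ?_
  rcases (hn i).eq_or_lt with h | h
  · simp [← h]
  · change _ = ((n i * (U (x i)).toReal : ℝ) : EReal)
    rw [EReal.coe_mul, EReal.coe_toReal (hU.ne_top (hx i)) (hb i h)]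

theorem totalUtility_eq_bot {i : I} (hi : 0 < n i) (hb : U (x i) = ⊥) :
    totalUtility U n x = ⊥ := by
  rw [totalUtility, ← add_sum_erase _ _ (mem_univ i), hb, EReal.coe_mul_bot_of_pos hi,
    EReal.bot_add]

/-- Some feasible rates are all positive. -/
theorem exists_isFeasible_pos (hres : ∀ i, (res i).Nonempty) (hC : ∀ j, 0 < C j)
    (hn : ∀ i, 0 ≤ n i) (hn_ex : ∃ i, 0 < n i) :
    ∃ x : I → ℝ, IsFeasible res C n x ∧ ∀ i, 0 < x i := by
  have hN : 0 < ∑ i, n i := by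
    obtain ⟨i, hi⟩ := hn_ex
    exact sum_pos' (fun i _ => hn i) ⟨i, mem_univ i, hi⟩
  -- Each flow gets on every resource it can use the share it would have if all flows competed
  -- there.
  refine ⟨_, ⟨fun _ j => C j / ∑ i, n i, fun i j _ => (div_pos (hC j) hN).le, fun i => rfl,
    fun j => ?_⟩, fun i => sum_pos (fun j _ => div_pos (hC j) hN) (hres i)⟩
  rw [← sum_mul]
  calc (∑ i with j ∈ res i, n i) * (C j / ∑ i, n i)
      ≤ (∑ i, n i) * (C j / ∑ i, n i) :=
        mul_le_mul_of_nonneg_right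
          (sum_le_sum_of_subset_of_nonneg (filter_subset _ _) fun i _ _ => hn i)
          (div_pos (hC j) hN).le
    _ = C j := mul_div_cancel₀ _ hN.ne'

theorem IsRateAllocation.utility_ne_bot (hres : ∀ i, (res i).Nonempty) (hC : ∀ j, 0 < C j)
    (hn : ∀ i, 0 ≤ n i) (hn_ex : ∃ i, 0 < n i) (hU : IsUtility U)
    (hx : IsRateAllocation U res C n x) (i : I) (hi : 0 < n i) : U (x i) ≠ ⊥ := by
  intro hb
  obtain ⟨z, hz, hz0⟩ := exists_isFeasible_pos hres hC hn hn_ex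
  have h := hx.2.2 z hz
  rw [totalUtility_eq_bot hi hb, le_bot_iff,
    totalUtility_eq_coe hU hn (fun i => (hz0 i).le) fun i _ => hU.ne_bot (hz0 i)] at h
  exact EReal.coe_ne_bot _ h

/-- Optimality against a perturbation, in real numbers. Unperturbed types may have rate `0`, while
perturbed ones must end at a positive rate so that their utility is finite. -/
theorem IsRateAllocation.sum_le (hres : ∀ i, (res i).Nonempty) (hC : ∀ j, 0 < C j)
    (hn : ∀ i, 0 ≤ n i) (hn_ex : ∃ i, 0 < n i) (hU : IsUtility U)
    (hx : IsRateAllocation U res C n x) (hx0 : ∀ i, 0 ≤ x i) (d : I → ℝ)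
    (hfeas : IsFeasible res C n (fun i => x i + d i)) (hd : ∀ i, d i = 0 ∨ 0 < x i + d i) :
    ∑ i, n i * ((U (x i + d i)).toReal - (U (x i)).toReal) ≤ 0 := by
  have hb := hx.utility_ne_bot hres hC hn hn_ex hU
  have h := hx.2.2 _ hfeas
  rw [totalUtility_eq_coe hU hn hx0 hb, totalUtility_eq_coe hU hn, EReal.coe_le_coe_iff] at h
  · simpa [mul_sub] using h
  · intro i
    rcases hd i with h0 | h0
    · simpa [h0] using hx0 i
    · exact h0.le
  · intro i hi
    rcases hd i with h0 | h0
    · simpa [h0] using hb i hi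
    · exact hU.ne_bot h0

theorem IsRateAllocation.exists_isFairSplit (hres : ∀ i, (res i).Nonempty) (hC : ∀ j, 0 < C j)
    (hn : ∀ i, 0 ≤ n i) (hn_ex : ∃ i, 0 < n i) (hU : IsUtility U)
    (hx : IsRateAllocation U res C n x) : ∃ y, IsFairSplit res C n x y := by
  obtain ⟨y, h1, h2, h3⟩ := hx.1
  have hy : IsSplit res C n x y := ⟨h1, h2, h3⟩
  have hx0 := hy.rate_nonneg
  have hb := hx.utility_ne_bot hres hC hn hn_ex hU
  refine ⟨y, hy, fun i k j hi hk hji hjk hyij => ?_, fun i j hi hj => ?_⟩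
  · by_contra! hlt
    have hne : i ≠ k := by rintro rfl; exact lt_irrefl _ hlt
    obtain ⟨e, he0, he1, he2⟩ : ∃ e > 0, e / n i ≤ y i j ∧ e / n k + e / n i < x i - x k := by
      -- `e` is the load moved on `j` from type `i` to type `k`. The first bound keeps `y i j`
      -- nonnegative; the second, halved for strictness, keeps `i` better off than `k`.
      refine ⟨min (n i * y i j) ((x i - x k) / (1 / n k + 1 / n i) / 2), ?_, ?_, ?_⟩
      · have : 0 < x i - x k := by linarith
        positivity
      · rw [div_le_iff₀ hi, mul_comm]
        exact min_le_left _ _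
      · have hs : 0 < 1 / n k + 1 / n i := by positivity
        set e := min (n i * y i j) ((x i - x k) / (1 / n k + 1 / n i) / 2)
        have : e < (x i - x k) / (1 / n k + 1 / n i) :=
          (min_le_right _ _).trans_lt (half_lt_self (div_pos (by linarith) hs))
        rw [lt_div_iff₀ hs] at this
        calc e / n k + e / n i = e * (1 / n k + 1 / n i) := by ring
          _ < _ := this
    have ha : 0 < e / n i := div_pos he0 hi
    have hbk : 0 < e / n k := div_pos he0 hk
    let d : I → ℝ := fun l => if l = i then -(e / n i) else if l = k then e / n k else 0
    have di : d i = -(e / n i) := by simp [d]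
    have dk : d k = e / n k := by simp [d, hne.symm]
    have d0 : ∀ l, l ≠ i ∧ l ≠ k → d l = 0 := fun l hl => by simp [d, hl.1, hl.2]
    have hcancel : ∑ l, n l * d l = 0 := by
      rw [Fintype.sum_eq_add i k hne fun l hl => by rw [d0 l hl, mul_zero], di, dk]
      field_simp
      ring
    have hfeas := hy.shift j d
      (fun l hl => d0 l ⟨fun h => hl (h ▸ hji), fun h => hl (h ▸ hjk)⟩)
      (fun l hl => by
        by_cases hli : l = i
        · subst hli; rw [di]; linarith
        by_cases hlk : l = k
        · subst hlk; rw [dk]; linarith [h1 l j hl]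
        · rw [d0 l ⟨hli, hlk⟩]; linarith [h1 l j hl])
      (by rw [hcancel, add_zero]; exact h3 j)
    have hle := hx.sum_le hres hC hn hn_ex hU hx0 d hfeas fun l => by
      by_cases hli : l = i
      · right; subst hli; rw [di]; linarith [hx0 k]
      by_cases hlk : l = k
      · right; subst hlk; rw [dk]; linarith [hx0 l]
      · exact Or.inl (d0 l ⟨hli, hlk⟩)
    rw [Fintype.sum_eq_add i k hne fun l hl => by simp [d0 l hl], di, dk, ← sub_eq_add_neg] at hle
    have := hU.transfer_lt (v := n i) (w := n k) (hx0 k) (hb k hk) ha hbk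
      (by linarith : x k + e / n k < x i - e / n i) hi (by field_simp)
    linarith
  · by_contra hload
    have hlt := lt_of_le_of_ne (h3 j) hload
    -- All spare capacity of `j` is handed to type `i`.
    set s := C j - ∑ k with j ∈ res k, n k * y k j with hs
    have hs0 : 0 < s / n i := div_pos (by linarith) hi
    let d : I → ℝ := fun l => if l = i then s / n i else 0
    have di : d i = s / n i := by simp [d]
    have d0 : ∀ l, l ≠ i → d l = 0 := fun l hl => by simp [d, hl]
    have hfeas := hy.shift j d (fun l hl => d0 l fun h => hl (h ▸ hj))
      (fun l hl => by
        by_cases hli : l = i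
        · subst hli; rw [di]; linarith [h1 l j hl]
        · rw [d0 l hli]; linarith [h1 l j hl])
      (by
        rw [Fintype.sum_eq_single i fun l hl => by rw [d0 l hl, mul_zero], di,
          mul_div_cancel₀ _ hi.ne', hs]
        linarith)
    have hle := hx.sum_le hres hC hn hn_ex hU hx0 d hfeas fun l => by
      by_cases hli : l = i
      · right; subst hli; rw [di]; linarith [hx0 l]
      · exact Or.inl (d0 l hli)
    rw [Fintype.sum_eq_single i fun l hl => by simp [d0 l hl], di] at hle
    have := mul_pos hi (sub_pos.2 (hU.toReal_lt (hx0 i) (hb i hi)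
      (by linarith : x i < x i + s / n i)))
    linarith

end Allocation

/-! ### Load counting, and sets of resources for which the bounds are tight. -/

section Tight

variable {I J : Type*} [Fintype I] [Fintype J] [DecidableEq I] [DecidableEq J]
  {res : I → Finset J} {C : J → ℝ} {n x : I → ℝ} {y : I → J → ℝ}

/-- The total load of the resources in `J'`, summed over flow types instead of resources. -/
theorem sum_load_eq (res : I → Finset J) (n : I → ℝ) (y : I → J → ℝ) (J' : Finset J) :
    ∑ j ∈ J', ∑ i with j ∈ res i, n i * y i j = ∑ i, n i * ∑ j ∈ res i ∩ J', y i j := by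
  simp_rw [sum_filter, mul_sum]
  rw [sum_comm]
  refine sum_congr rfl fun i _ => ?_
  rw [← sum_filter, filter_mem_eq_inter, inter_comm]

theorem IsSplit.sum_inter_nonneg (hy : IsSplit res C n x y) (i : I) (J' : Finset J) :
    0 ≤ ∑ j ∈ res i ∩ J', y i j :=
  sum_nonneg fun j hj => hy.nonneg i j (mem_of_mem_inter_left hj)

theorem IsSplit.sum_inter_le (hy : IsSplit res C n x y) (i : I) (J' : Finset J) :
    ∑ j ∈ res i ∩ J', y i j ≤ x i := by
  rw [← hy.sum_eq i]
  exact sum_le_sum_of_subset_of_nonneg inter_subset_left fun j hj _ => hy.nonneg i j hj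

/-- Confined types place their whole rate, at least `m` per flow, on `J'`. -/
theorem IsSplit.mul_confined_le (hy : IsSplit res C n x y) (hn : ∀ i, 0 ≤ n i) {m : ℝ}
    (hm : ∀ i, 0 < n i → m ≤ x i) (J' : Finset J) :
    m * ∑ i ∈ confinedTo res J', n i ≤ ∑ j ∈ J', C j := by
  calc m * ∑ i ∈ confinedTo res J', n i
      = ∑ i ∈ confinedTo res J', n i * m := by rw [mul_comm, sum_mul]
    _ ≤ ∑ i ∈ confinedTo res J', n i * ∑ j ∈ res i ∩ J', y i j := by
        refine sum_le_sum fun i hi => ?_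
        rw [inter_eq_left.2 (mem_filter.1 hi).2, hy.sum_eq i]
        rcases (hn i).eq_or_lt with h | h
        · simp [← h]
        · exact mul_le_mul_of_nonneg_left (hm i h) h.le
    _ ≤ ∑ i, n i * ∑ j ∈ res i ∩ J', y i j :=
        sum_le_sum_of_subset_of_nonneg (subset_univ _) fun i _ _ =>
          mul_nonneg (hn i) (hy.sum_inter_nonneg i J')
    _ = ∑ j ∈ J', ∑ i with j ∈ res i, n i * y i j := (sum_load_eq res n y J').symm
    _ ≤ ∑ j ∈ J', C j := sum_le_sum fun j _ => hy.load_le j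

/-- Each resource in `J'` is usable by a present type, hence full, and only touching types load it,
with at most `M` per flow. -/
theorem IsFairSplit.le_mul_touching (hy : IsFairSplit res C n x y) (hn : ∀ i, 0 ≤ n i) {M : ℝ}
    (hM : ∀ i, x i ≤ M) (J' : Finset J) (hJ' : ∀ j ∈ J', ∃ i, j ∈ res i ∧ 0 < n i) :
    ∑ j ∈ J', C j ≤ M * ∑ i ∈ touching res J', n i := by
  calc ∑ j ∈ J', C j = ∑ j ∈ J', ∑ i with j ∈ res i, n i * y i j := by
        refine sum_congr rfl fun j hj => ?_
        obtain ⟨i, hji, hi⟩ := hJ' j hj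
        exact (hy.load_eq i j hi hji).symm
    _ = ∑ i, n i * ∑ j ∈ res i ∩ J', y i j := sum_load_eq res n y J'
    _ = ∑ i ∈ touching res J', n i * ∑ j ∈ res i ∩ J', y i j := by
        refine (sum_filter_of_ne fun i _ hne => ?_).symm
        by_contra hi
        rw [not_nonempty_iff_eq_empty] at hi
        exact hne (by rw [hi, sum_empty, mul_zero])
    _ ≤ ∑ i ∈ touching res J', n i * M :=
        sum_le_sum fun i _ => mul_le_mul_of_nonneg_left
          ((hy.sum_inter_le i J').trans (hM i)) (hn i)
    _ = M * ∑ i ∈ touching res J', n i := by rw [← sum_mul, mul_comm]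

/-- The resources available to the worst-off flow types are shared among these types only. -/
theorem IsFairSplit.exists_tight_confined (hy : IsFairSplit res C n x y)
    (hres : ∀ i, (res i).Nonempty) (hn : ∀ i, 0 ≤ n i) {i₀ : I} (hi₀ : 0 < n i₀)
    (hmin : ∀ i, 0 < n i → x i₀ ≤ x i) :
    ∃ J' : Finset J, J'.Nonempty ∧
      ∑ j ∈ J', C j = x i₀ * ∑ i ∈ confinedTo res J', n i := by
  set J₀ : Finset J := univ.filter fun j => ∃ i, 0 < n i ∧ x i = x i₀ ∧ j ∈ res i with hJ₀
  have hmem : ∀ j, j ∈ J₀ ↔ ∃ i, 0 < n i ∧ x i = x i₀ ∧ j ∈ res i := fun j => by simp [hJ₀]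
  have hsub : ∀ i, 0 < n i → x i = x i₀ → res i ⊆ J₀ := fun i hi he j hj =>
    (hmem j).2 ⟨i, hi, he, hj⟩
  -- By fairness, a better-off type uses no resource available to a worst-off type.
  have hzero : ∀ i, 0 < n i → x i ≠ x i₀ → ∑ j ∈ res i ∩ J₀, y i j = 0 := by
    intro i hi hne
    refine sum_eq_zero fun j hj => ?_
    obtain ⟨hji, hj0⟩ := mem_inter.1 hj
    obtain ⟨k, hk, hke, hjk⟩ := (hmem j).1 hj0
    by_contra h
    have := hy.le_of_used i k j hi hk hji hjk (lt_of_le_of_ne (hy.nonneg i j hji) (Ne.symm h))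
    exact hne (le_antisymm (hke ▸ this) (hmin i hi))
  refine ⟨J₀, (hres i₀).mono (hsub i₀ hi₀ rfl), le_antisymm ?_ (hy.mul_confined_le hn hmin J₀)⟩
  calc ∑ j ∈ J₀, C j = ∑ j ∈ J₀, ∑ i with j ∈ res i, n i * y i j := by
        refine sum_congr rfl fun j hj => ?_
        obtain ⟨i, hi, -, hji⟩ := (hmem j).1 hj
        exact (hy.load_eq i j hi hji).symm
    _ = ∑ i, n i * ∑ j ∈ res i ∩ J₀, y i j := sum_load_eq res n y J₀
    _ ≤ ∑ i, if res i ⊆ J₀ then n i * x i₀ else 0 := by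
        refine sum_le_sum fun i _ => ?_
        rcases (hn i).eq_or_lt with h | h
        · simp [← h]
        by_cases he : x i = x i₀
        · rw [if_pos (hsub i h he), ← he]
          exact mul_le_mul_of_nonneg_left (hy.sum_inter_le i J₀) h.le
        · rw [hzero i h he, mul_zero]
          split_ifs
          · exact mul_nonneg h.le (hy.rate_nonneg i₀)
          · exact le_rfl
    _ = x i₀ * ∑ i ∈ confinedTo res J₀, n i := by
        rw [← sum_filter, ← sum_mul, mul_comm, confinedTo]

/-- The resources used by the best-off flow types are available to these types only. -/
theorem IsFairSplit.exists_tight_touching (hy : IsFairSplit res C n x y)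
    (hn : ∀ i, 0 ≤ n i) {i₁ : I} (hi₁ : 0 < n i₁) (hpos : 0 < x i₁)
    (hmax : ∀ i, x i ≤ x i₁) :
    ∃ J' : Finset J, J'.Nonempty ∧ (∀ j ∈ J', ∃ i, j ∈ res i ∧ 0 < n i) ∧
      ∑ j ∈ J', C j = x i₁ * ∑ i ∈ touching res J', n i := by
  set J₁ : Finset J :=
    univ.filter fun j => ∃ i, 0 < n i ∧ x i = x i₁ ∧ j ∈ res i ∧ 0 < y i j with hJ₁
  have hmem : ∀ j, j ∈ J₁ ↔ ∃ i, 0 < n i ∧ x i = x i₁ ∧ j ∈ res i ∧ 0 < y i j :=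
    fun j => by simp [hJ₁]
  have husable : ∀ j ∈ J₁, ∃ i, j ∈ res i ∧ 0 < n i := fun j hj => by
    obtain ⟨i, hi, -, hji, -⟩ := (hmem j).1 hj
    exact ⟨i, hji, hi⟩
  have hall : ∀ i, 0 < n i → x i = x i₁ → ∑ j ∈ res i ∩ J₁, y i j = x i := by
    intro i hi he
    rw [← hy.sum_eq i]
    refine sum_subset inter_subset_left fun j hj hj' => ?_
    by_contra h
    exact hj' (mem_inter.2 ⟨hj, (hmem j).2
      ⟨i, hi, he, hj, lt_of_le_of_ne (hy.nonneg i j hj) (Ne.symm h)⟩⟩)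
  refine ⟨J₁, ?_, husable, le_antisymm (hy.le_mul_touching hn hmax J₁ husable) ?_⟩
  · by_contra h
    rw [not_nonempty_iff_eq_empty] at h
    have := hall i₁ hi₁ rfl
    rw [h, inter_empty, sum_empty] at this
    exact hpos.ne this
  calc x i₁ * ∑ i ∈ touching res J₁, n i
      = ∑ i ∈ touching res J₁, n i * x i₁ := by rw [mul_comm, sum_mul]
    _ = ∑ i ∈ touching res J₁, n i * ∑ j ∈ res i ∩ J₁, y i j := by
        refine sum_congr rfl fun i hi => ?_
        rcases (hn i).eq_or_lt with h | h
        · simp [← h]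
        obtain ⟨j, hj⟩ := (mem_filter.1 hi).2
        obtain ⟨hji, hj1⟩ := mem_inter.1 hj
        obtain ⟨k, hk, hke, hjk, hyk⟩ := (hmem j).1 hj1
        have he : x i = x i₁ :=
          le_antisymm (hmax i) (hke ▸ hy.le_of_used k i j hk h hjk hji hyk)
        rw [hall i h he, he]
    _ ≤ ∑ i, n i * ∑ j ∈ res i ∩ J₁, y i j :=
        sum_le_sum_of_subset_of_nonneg (subset_univ _) fun i _ _ =>
          mul_nonneg (hn i) (hy.sum_inter_nonneg i J₁)
    _ = ∑ j ∈ J₁, ∑ i with j ∈ res i, n i * y i j := (sum_load_eq res n y J₁).symm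
    _ ≤ ∑ j ∈ J₁, C j := sum_le_sum fun j _ => hy.load_le j

/-! ### Connectedness of minimal tight sets. -/

/-- A smallest tight set for the lower bound is strongly connected. -/
theorem exists_stronglyConnected_tight (hn : ∀ i, 0 ≤ n i) {m : ℝ} (hm : 0 ≤ m)
    (hbound : ∀ J' : Finset J, m * ∑ i ∈ confinedTo res J', n i ≤ ∑ j ∈ J', C j)
    (htight : ∃ J' : Finset J, J'.Nonempty ∧
      ∑ j ∈ J', C j = m * ∑ i ∈ confinedTo res J', n i) :
    ∃ J' ∈ stronglyConnectedSets res, ∑ j ∈ J', C j = m * ∑ i ∈ confinedTo res J', n i := by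
  obtain ⟨J', ⟨hne, ht⟩, hminimal⟩ := exists_minimal_of_wellFoundedLT
    (fun J' : Finset J => J'.Nonempty ∧ ∑ j ∈ J', C j = m * ∑ i ∈ confinedTo res J', n i) htight
  refine ⟨J', ⟨hne, ?_⟩, ht⟩
  rintro ⟨J₁, J₂, hJ₁, hJ₂, hdisj, hunion, I₁, I₂, hI, hIu, h₁, h₂⟩
  have hsub : ∀ {A B : Finset J} {K : Finset I}, A ∪ B = J' → K ⊆ confinedTo res J' →
      (∀ i ∈ K, Disjoint (res i) B) → K ⊆ confinedTo res A := by
    intro A B K hAB hK hd i hi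
    refine mem_filter.2 ⟨mem_univ i, fun j hj => ?_⟩
    have hj' : j ∈ A ∪ B := hAB ▸ (mem_filter.1 (hK hi)).2 hj
    exact (mem_union.1 hj').resolve_right (disjoint_left.1 (hd i hi) hj)
  have s₁ := sum_le_sum_of_subset_of_nonneg
    (hsub hunion (hIu ▸ subset_union_left) h₁) fun i _ _ => hn i
  have s₂ := sum_le_sum_of_subset_of_nonneg
    (hsub ((union_comm _ _).trans hunion) (hIu ▸ subset_union_right) h₂) fun i _ _ => hn i
  have b₁ := hbound J₁
  have b₂ := hbound J₂
  rw [← hIu, sum_union hI, ← hunion, sum_union hdisj, mul_add] at ht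
  have t₁ := mul_le_mul_of_nonneg_left s₁ hm
  have t₂ := mul_le_mul_of_nonneg_left s₂ hm
  -- The bounds for `J₁` and `J₂` add up to the equality for `J'`, so `J₁` is itself tight.
  have hle : J' ⊆ J₁ :=
    hminimal (y := J₁) ⟨hJ₁, by linarith⟩ (hunion ▸ subset_union_left)
  obtain ⟨j, hj⟩ := hJ₂
  exact disjoint_left.1 hdisj (hle (hunion ▸ mem_union_right _ hj)) hj

/-- A smallest tight set for the upper bound is connected. -/
theorem exists_connected_tight {M : ℝ} {P : J → Prop}
    (hbound : ∀ J' : Finset J, (∀ j ∈ J', P j) →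
      ∑ j ∈ J', C j ≤ M * ∑ i ∈ touching res J', n i)
    (htight : ∃ J' : Finset J, J'.Nonempty ∧ (∀ j ∈ J', P j) ∧
      ∑ j ∈ J', C j = M * ∑ i ∈ touching res J', n i) :
    ∃ J' ∈ connectedSets res, ∑ j ∈ J', C j = M * ∑ i ∈ touching res J', n i := by
  obtain ⟨J', ⟨hne, hP, ht⟩, hminimal⟩ := exists_minimal_of_wellFoundedLT
    (fun J' : Finset J => J'.Nonempty ∧ (∀ j ∈ J', P j) ∧
      ∑ j ∈ J', C j = M * ∑ i ∈ touching res J', n i) htight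
  refine ⟨J', ⟨hne, ?_⟩, ht⟩
  rintro ⟨J₁, J₂, hJ₁, hJ₂, hdisj, hunion, I₁, I₂, hI, hIu, h₁, h₂⟩
  have hsub₁ : touching res J₁ ⊆ I₁ := fun i hi => by
    refine (mem_union.1 (hIu ▸ mem_univ i : i ∈ I₁ ∪ I₂)).resolve_right fun h => ?_
    exact not_disjoint_iff_nonempty_inter.2 (mem_filter.1 hi).2 (h₂ i h)
  have hsub₂ : touching res J₂ ⊆ I₂ := fun i hi => by
    refine (mem_union.1 (hIu ▸ mem_univ i : i ∈ I₁ ∪ I₂)).resolve_left fun h => ?_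
    exact not_disjoint_iff_nonempty_inter.2 (mem_filter.1 hi).2 (h₁ i h)
  have htouch : touching res J' = touching res J₁ ∪ touching res J₂ := by
    ext i
    simp only [touching, mem_filter, mem_univ, true_and, mem_union, ← hunion,
      inter_union_distrib_left, union_nonempty]
  have hP₁ : ∀ j ∈ J₁, P j := fun j hj => hP j (hunion ▸ mem_union_left _ hj)
  have hP₂ : ∀ j ∈ J₂, P j := fun j hj => hP j (hunion ▸ mem_union_right _ hj)
  have b₁ := hbound J₁ hP₁
  have b₂ := hbound J₂ hP₂
  -- No type touches both parts, so both sides of the bound are additive and `J₁` is again tight.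
  rw [htouch, sum_union (hI.mono hsub₁ hsub₂), ← hunion, sum_union hdisj, mul_add] at ht
  have hle : J' ⊆ J₁ :=
    hminimal (y := J₁) ⟨hJ₁, hP₁, by linarith⟩ (hunion ▸ subset_union_left)
  obtain ⟨j, hj⟩ := hJ₂
  exact disjoint_left.1 hdisj (hle (hunion ▸ mem_union_right _ hj)) hj

/-- A connected set that some flow type can use contains no useless resource. -/
theorem exists_mem_res_of_connected {J' : Finset J} (hJ' : J' ∈ connectedSets res)
    (ht : (touching res J').Nonempty) {j : J} (hj : j ∈ J') : ∃ i, j ∈ res i := by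
  by_contra! hno
  obtain ⟨i, hi⟩ := ht
  obtain ⟨k, hk⟩ := (mem_filter.1 hi).2
  obtain ⟨hki, hkJ⟩ := mem_inter.1 hk
  -- A resource that no type can use splits off as a part with no types attached.
  refine hJ'.2 ⟨J'.erase j, {j}, ⟨k, mem_erase.2 ⟨?_, hkJ⟩⟩, singleton_nonempty j, by simp, ?_,
    univ, ∅, by simp, by simp, fun i _ => by simpa using hno i, by simp⟩
  · rintro rfl
    exact hno i hki
  · rw [union_comm, ← insert_eq, insert_erase hj]

end Tight

end MultipathRouting

theorem theorem2 {I J : Type*} [Fintype I] [Fintype J] [DecidableEq I] [DecidableEq J]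
    (res : I → Finset J) (hres : ∀ i, (res i).Nonempty)
    (C : J → ℝ) (hC : ∀ j, 0 < C j)
    (n : I → ℝ) (hn : ∀ i, 0 ≤ n i) (hn_ex : ∃ i, 0 < n i)
    (U : ℝ → EReal) (hU : MultipathRouting.IsUtility U)
    (x : I → ℝ) (hx : MultipathRouting.IsRateAllocation U res C n x) :
    (∃ m : ℝ,
      IsLeast (x '' {i | 0 < n i}) m ∧
      IsLeast
        {r : ℝ | ∃ J' ∈ MultipathRouting.stronglyConnectedSets res,
          0 < ∑ i ∈ MultipathRouting.confinedTo res J', n i ∧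
          r = (∑ j ∈ J', C j) / ∑ i ∈ MultipathRouting.confinedTo res J', n i} m) ∧
    ((∀ j, (∃ i, j ∈ res i) → ∃ i, j ∈ res i ∧ 0 < n i) →
      ∃ M : ℝ,
        IsGreatest (Set.range x) M ∧
        IsGreatest
          {r : ℝ | ∃ J' ∈ MultipathRouting.connectedSets res,
            0 < ∑ i ∈ MultipathRouting.touching res J', n i ∧
            r = (∑ j ∈ J', C j) / ∑ i ∈ MultipathRouting.touching res J', n i} M) := by
  obtain ⟨y, hy⟩ := hx.exists_isFairSplit hres hC hn hn_ex hU
  have hCpos : ∀ J' : Finset J, J'.Nonempty → 0 < ∑ j ∈ J', C j := fun J' hJ' =>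
    sum_pos (fun j _ => hC j) hJ'
  obtain ⟨i₀, hi₀, hmin⟩ : ∃ i₀, 0 < n i₀ ∧ ∀ i, 0 < n i → x i₀ ≤ x i := by
    obtain ⟨i₀, hi₀, h⟩ := exists_min_image (univ.filter fun i => 0 < n i) x
      (by simpa [Finset.Nonempty] using hn_ex)
    exact ⟨i₀, by simpa using hi₀, fun i hi => h i (by simpa using hi)⟩
  have hpos : 0 < x i₀ := by
    obtain ⟨J', hne, h⟩ := hy.exists_tight_confined hres hn hi₀ hmin
    exact pos_of_mul_pos_left (h ▸ hCpos J' hne) (sum_nonneg fun i _ => hn i)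
  refine ⟨⟨x i₀, ⟨⟨i₀, hi₀, rfl⟩, ?_⟩, ?_, ?_⟩, fun huse => ?_⟩
  · rintro _ ⟨i, hi, rfl⟩
    exact hmin i hi
  · obtain ⟨J', hJ', h⟩ := MultipathRouting.exists_stronglyConnected_tight hn hpos.le
      (hy.mul_confined_le hn hmin) (hy.exists_tight_confined hres hn hi₀ hmin)
    have hN := pos_of_mul_pos_right (h ▸ hCpos J' hJ'.1) hpos.le
    exact ⟨J', hJ', hN, (eq_div_iff hN.ne').2 h.symm⟩
  · rintro _ ⟨J', -, hN, rfl⟩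
    exact (le_div_iff₀ hN).2 (hy.mul_confined_le hn hmin J')
  obtain ⟨i₁, -, hmax⟩ := exists_max_image univ x ⟨i₀, mem_univ i₀⟩
  replace hmax : ∀ i, x i ≤ x i₁ := fun i => hmax i (mem_univ i)
  have hpos₁ : 0 < x i₁ := hpos.trans_le (hmax i₀)
  -- Absent types have rate `0` by convention, so a type of positive rate is present.
  have hi₁ : 0 < n i₁ := lt_of_le_of_ne (hn i₁) fun h => hpos₁.ne' (hx.2.1 i₁ h.symm)
  refine ⟨x i₁, ⟨⟨i₁, rfl⟩, ?_⟩, ?_, ?_⟩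
  · rintro _ ⟨i, rfl⟩
    exact hmax i
  · obtain ⟨J', hJ', h⟩ := MultipathRouting.exists_connected_tight
      (hy.le_mul_touching hn hmax) (hy.exists_tight_touching hn hi₁ hpos₁ hmax)
    have hN := pos_of_mul_pos_right (h ▸ hCpos J' hJ'.1) hpos₁.le
    exact ⟨J', hJ', hN, (eq_div_iff hN.ne').2 h.symm⟩
  · rintro _ ⟨J', hJ', hN, rfl⟩
    refine (div_le_iff₀ hN).2 (hy.le_mul_touching hn hmax J' fun j hj => huse j ?_)
    refine MultipathRouting.exists_mem_res_of_connected hJ' ?_ hj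
    exact nonempty_of_sum_ne_zero hN.ne'
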